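/- Let $a,b>0$ and $m\in\mathbb R$, and let $X_1,X_2,\dots$ be i.i.d. random variables with the symmetric variance-gamma distribution with location $m$, shape $a$ and scale $b$, that is, with the law of $m+\sqrt{bG}\,Z$, where $G\sim\Gamma(a,1)$ and $Z\sim\mathcal N(0,1)$ are independent. For $N\ge 1$ let $$\overline X=\frac1N\sum_{i=1}^N X_i,\qquad \hat V=\frac1N\sum_{i=1}^N (X_i-\overline X)^2,\qquad \hat K=\frac1N\sum_{i=1}^N (X_i-\overline X)^4,$$ $$\hat a=\frac{3\hat V^2}{\hat K-3\hat V^2},\qquad \hat b=\frac{\hat K}{3\hat V}-\hat V .$$ Then the estimators $(\overline X,\hat a,\hat b)$ of $(m,a,b)$ are asymptotically normal with block diagonal limiting covariance matrix: as $N\to\infty$, $$\sqrt N\,\bigl[(\overline X,\hat a,\hat b)-(m,a,b)\bigr]\ \to_d\ \mathcal N_3\bigl(0,\ \mathrm{diag}(ab,\Sigma)\bigr),$$ where $$\Sigma=\frac13\begin{bmatrix}2(4a^4+36a^3+95a^2+63a) & -2(4a^3+36a^2+101a+69)\,b\\ -2(4a^3+36a^2+101a+69)\,b & (8a^2+72a+220+159a^{-1})\,b^2\end{bmatrix}.$$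 (The estimators may be given arbitrary values where a denominator vanishes; this has probability tending to $0$.) -/

import Mathlib

open MeasureTheory ProbabilityTheory Filter Topology

noncomputable section

namespace SVG

/-- The symmetric variance-gamma law with location `m`, shape `a` and scale `b`: the law of
`m + √(b G) Z`, where `G ∼ Γ(a, 1)` and `Z ∼ N(0, 1)` are independent. -/
def law (m a b : ℝ) : Measure ℝ :=
  ((gammaMeasure a 1).prod (gaussianReal 0 1)).map (fun p => m + √(b * p.1) * p.2)

/-- The empirical mean of `x 0, …, x (N - 1)`. -/
def mean (x : ℕ → ℝ) (N : ℕ) : ℝ :=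
  (∑ i ∈ Finset.range N, x i) / N

/-- The empirical centered moment of order two of `x 0, …, x (N - 1)`. -/
def vHat (x : ℕ → ℝ) (N : ℕ) : ℝ :=
  (∑ i ∈ Finset.range N, (x i - mean x N) ^ 2) / N

/-- The empirical centered moment of order four of `x 0, …, x (N - 1)`. -/
def kHat (x : ℕ → ℝ) (N : ℕ) : ℝ :=
  (∑ i ∈ Finset.range N, (x i - mean x N) ^ 4) / N

/-- The moment estimator of the shape parameter. -/
def aHat (x : ℕ → ℝ) (N : ℕ) : ℝ :=
  3 * vHat x N ^ 2 / (kHat x N - 3 * vHat x N ^ 2)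

/-- The moment estimator of the scale parameter. -/
def bHat (x : ℕ → ℝ) (N : ℕ) : ℝ :=
  kHat x N / (3 * vHat x N) - vHat x N

/-- The limiting covariance matrix of the moment estimators of `(a, b)`. -/
def sigma (a b : ℝ) : Matrix (Fin 2) (Fin 2) ℝ :=
  (1 / 3 : ℝ) •
    !![2 * (4 * a ^ 4 + 36 * a ^ 3 + 95 * a ^ 2 + 63 * a),
        -2 * (4 * a ^ 3 + 36 * a ^ 2 + 101 * a + 69) * b;
       -2 * (4 * a ^ 3 + 36 * a ^ 2 + 101 * a + 69) * b,
        (8 * a ^ 2 + 72 * a + 220 + 159 * a⁻¹) * b ^ 2]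

/-- The block diagonal matrix `diag(ab, Σ)`. -/
def limitCov (a b : ℝ) : Matrix (Fin 3) (Fin 3) ℝ :=
  !![a * b, 0, 0;
     0, sigma a b 0 0, sigma a b 0 1;
     0, sigma a b 1 0, sigma a b 1 1]

end SVG

end

/-! The method of moments is the delta method applied to the averages of the vectors `powers m (X
k)`. Conditioning on the gamma variable, the odd central moments vanish and those of order `2 * k`
are products of the factors `b * (a + j) * (2 * j + 1)`, `j < k`. Hence V = ab and K = 3a(a+1)b²,
and solving for a and b gives the formulas of the estimators.

For `N ≠ 0` the estimators are exactly `momentMap m` of the averaged powers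
(`momentMap_mean_powers`). The vector central limit theorem, which needs moments up to order eight,
gives a Gaussian limit with covariance C = `momentCov`; the delta method turns it into J C Jᵀ, with
J = `jacobian`. Vanishing odd moments make the blocks decouple: even and odd powers are
uncorrelated, and replacing m by the sample mean has no first-order effect on V and K. -/

namespace ProbabilityTheory

open scoped Matrix

/-! ### Convergence in distribution and the delta method -/

section Limits

variable {Ω Ω' : Type*} {mΩ : MeasurableSpace Ω} {mΩ' : MeasurableSpace Ω'}
  {P : Measure Ω} [IsProbabilityMeasure P] {P' : Measure Ω'} [IsProbabilityMeasure P']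

/-- The limit in a convergence in distribution only matters through its law. -/
theorem tendstoInDistribution_of_map_eq {Ω'' E : Type*} {mΩ'' : MeasurableSpace Ω''}
    {P'' : Measure Ω''} [IsProbabilityMeasure P''] [TopologicalSpace E] [MeasurableSpace E]
    [OpensMeasurableSpace E] {X : ℕ → Ω → E} {Z : Ω' → E} {T : Ω'' → E}
    (h : TendstoInDistribution X atTop Z (fun _ => P) P') (hT : AEMeasurable T P'')
    (hZT : P'.map Z = P''.map T) :
    TendstoInDistribution X atTop T (fun _ => P) P'' where
  forall_aemeasurable := h.forall_aemeasurable
  aemeasurable_limit := hT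
  tendsto := by
    have := h.tendsto
    convert! this using 2
    exact congrArg 𝓝 (Subtype.ext hZT.symm)

/-- **Delta method.** -/
theorem tendstoInDistribution_smul_comp_sub {E F : Type*}
    [NormedAddCommGroup E] [NormedSpace ℝ E] [MeasurableSpace E] [BorelSpace E]
    [SecondCountableTopology E]
    [NormedAddCommGroup F] [NormedSpace ℝ F] [MeasurableSpace F] [BorelSpace F]
    [SecondCountableTopology F]
    {T : ℕ → Ω → E} {θ : E} {Z : Ω' → E} {r : ℕ → ℝ} (hr : ∀ n, 0 ≤ r n)
    {g : E → F} {L : E →L[ℝ] F} (hg : HasFDerivAt g L θ) (hgm : Measurable g)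
    (hTm : ∀ n, AEMeasurable (T n) P)
    (hT : ∀ᵐ ω ∂P, Tendsto (fun n => T n ω) atTop (𝓝 θ))
    (h : TendstoInDistribution (fun n ω => r n • (T n ω - θ)) atTop Z (fun _ => P) P') :
    TendstoInDistribution (fun n ω => r n • (g (T n ω) - g θ)) atTop (fun ω => L (Z ω))
      (fun _ => P) P' := by
  -- The normalized Taylor remainder; since `0⁻¹ = 0`, it vanishes at `θ` and so is continuous
  -- there.
  set q : E → F := fun x => ‖x - θ‖⁻¹ • (g x - g θ - L (x - θ)) with hq
  have hqm : Measurable q := by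
    refine Measurable.smul (by fun_prop) (Measurable.sub (by fun_prop) ?_)
    exact L.continuous.measurable.comp (by fun_prop)
  have hq0 : Tendsto q (𝓝 θ) (𝓝 0) := by
    have := hasFDerivAt_iff_tendsto.1 hg
    rw [tendsto_zero_iff_norm_tendsto_zero]
    simpa [hq, norm_smul] using this
  have hqT : TendstoInMeasure P (fun n ω => q (T n ω)) atTop (fun _ => (0 : F)) := by
    refine tendstoInMeasure_of_tendsto_ae
      (fun n => (hqm.comp_aemeasurable (hTm n)).aestronglyMeasurable) ?_
    filter_upwards [hT] with ω hω using hq0.comp hω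
  -- Slutsky: the rescaled error is this function of `r n • (T n - θ)` and `q (T n)`, and the second
  -- argument tends to zero.
  have hG : Continuous (fun p : E × F => L p.1 + ‖p.1‖ • p.2) := by fun_prop
  have key := h.continuous_comp_prodMk_of_tendstoInMeasure_const hG hqT
    (fun n => hqm.comp_aemeasurable (hTm n))
  refine key.congr (fun n => ae_of_all _ fun ω => ?_) (ae_of_all _ fun ω => by simp)
  by_cases hx : T n ω = θ
  · simp [hq, hx]
  · have hx' : ‖T n ω - θ‖ ≠ 0 := norm_ne_zero_iff.2 (sub_ne_zero.2 hx)
    simp only [hq, norm_smul, Real.norm_of_nonneg (hr n), smul_smul, mul_assoc,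
      mul_inv_cancel₀ hx', mul_one, map_smul]
    rw [← smul_add]
    congr 1
    abel

end Limits

/-! ### Linear images of Gaussian vectors -/

section Gaussian

variable {ι κ : Type*} [Fintype ι] [DecidableEq ι] [Fintype κ] [DecidableEq κ]

/-- The image of a centered Gaussian vector under a linear map. -/
theorem map_multivariateGaussian_zero {S : Matrix ι ι ℝ} (hS : S.PosSemidef)
    (A : Matrix κ ι ℝ) (L : EuclideanSpace ℝ ι →L[ℝ] EuclideanSpace ℝ κ)
    (hL : ∀ x : EuclideanSpace ℝ ι, (L x).ofLp = A *ᵥ x.ofLp) :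
    (multivariateGaussian 0 S).map L = multivariateGaussian 0 (A * S * Aᵀ) := by
  have hAS : (A * S * Aᵀ).PosSemidef := by
    simpa using hS.mul_mul_conjTranspose_same A
  have : IsProbabilityMeasure ((multivariateGaussian 0 S).map L) :=
    Measure.isProbabilityMeasure_map (by fun_prop)
  refine Measure.ext_of_charFun (funext fun t => ?_)
  rw [charFun_multivariateGaussian hAS]
  have : charFun ((multivariateGaussian 0 S).map L) t =
      charFun (multivariateGaussian 0 S) (WithLp.toLp 2 (Aᵀ *ᵥ t.ofLp)) := by
    rw [charFun_apply, integral_map (by fun_prop) (by fun_prop), charFun_apply]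
    congr with x
    congr 3
    simp only [EuclideanSpace.inner_eq_star_dotProduct, star_trivial, hL]
    rw [Matrix.dotProduct_mulVec, Matrix.mulVec_transpose]
  rw [this, charFun_multivariateGaussian hS]
  simp only [inner_zero_right]
  congr 4
  rw [Matrix.mulVec_transpose, ← Matrix.mulVec_mulVec, ← Matrix.mulVec_mulVec,
    Matrix.dotProduct_mulVec t.ofLp, Matrix.mulVec_transpose]

end Gaussian

/-! ### The multivariate central limit theorem -/

section CLT

variable {Ω : Type*} {mΩ : MeasurableSpace Ω} {P : Measure Ω} [IsProbabilityMeasure P]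
  {ι : Type*} [Fintype ι] [DecidableEq ι] {W : ℕ → Ω → EuclideanSpace ℝ ι}

omit [DecidableEq ι] in
theorem variance_inner_eq_dotProduct_mulVec {V : Ω → EuclideanSpace ℝ ι}
    (hV : ∀ i, MemLp (fun ω => V ω i) 2 P) {S : Matrix ι ι ℝ}
    (hS : ∀ i j, S i j = cov[fun ω => V ω i, fun ω => V ω j; P]) (t : ι → ℝ) :
    Var[fun ω => inner ℝ (V ω) (WithLp.toLp 2 t); P] = t ⬝ᵥ S *ᵥ t := by
  have h (ω : Ω) : inner ℝ (V ω) (WithLp.toLp 2 t) = ∑ i, t i * V ω i := by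
    simp [PiLp.inner_apply]
  simp_rw [h]
  rw [variance_fun_sum fun i => (hV i).const_mul (t i)]
  simp_rw [covariance_const_mul_left, covariance_const_mul_right, ← hS, dotProduct,
    Matrix.mulVec, dotProduct, Finset.mul_sum]
  refine Finset.sum_congr rfl fun i _ => Finset.sum_congr rfl fun j _ => by ring

omit [DecidableEq ι] in
theorem posSemidef_of_eq_covariance {V : Ω → EuclideanSpace ℝ ι}
    (hV : ∀ i, MemLp (fun ω => V ω i) 2 P) {S : Matrix ι ι ℝ}
    (hS : ∀ i j, S i j = cov[fun ω => V ω i, fun ω => V ω j; P]) : S.PosSemidef := by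
  refine Matrix.PosSemidef.of_dotProduct_mulVec_nonneg ?_ fun t => ?_
  · ext i j
    simp [hS, covariance_comm]
  · rw [star_trivial, ← variance_inner_eq_dotProduct_mulVec hV hS]
    exact variance_nonneg _ _

/-- **Central limit theorem** in `ℝ^ι`. -/
theorem tendstoInDistribution_inv_sqrt_smul_sum_sub
    (hindep : iIndepFun W P) (hident : ∀ n, IdentDistrib (W n) (W 0) P P)
    (hW : ∀ i, MemLp (fun ω => W 0 ω i) 2 P) {c : EuclideanSpace ℝ ι}
    (hc : ∀ i, ∫ ω, W 0 ω i ∂P = c i) {S : Matrix ι ι ℝ}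
    (hS : ∀ i j, S i j = cov[fun ω => W 0 ω i, fun ω => W 0 ω j; P]) :
    TendstoInDistribution
      (fun (n : ℕ) ω => (√(n : ℝ))⁻¹ • (∑ k ∈ Finset.range n, W k ω - (n : ℝ) • c))
      atTop id (fun _ => P) (multivariateGaussian 0 S) where
  forall_aemeasurable n := by
    have (k : ℕ) : AEMeasurable (W k) P := (hident k).aemeasurable_fst
    fun_prop
  tendsto := by
    have hWm (k : ℕ) : AEMeasurable (W k) P := (hident k).aemeasurable_fst
    refine ProbabilityMeasure.tendsto_iff_tendsto_charFun.2 fun t => ?_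
    have hinner : Measurable fun x : EuclideanSpace ℝ ι => inner ℝ x t := by fun_prop
    set Y : ℕ → Ω → ℝ := fun k ω => inner ℝ (W k ω) t with hYdef
    have hYsum (k : ℕ) (ω : Ω) : Y k ω = ∑ i, t i * W k ω i := by
      simp [hYdef, PiLp.inner_apply]
    have hYL2 : MemLp (Y 0) 2 P := by
      have : Y 0 = fun ω => ∑ i, t i * W 0 ω i := funext (hYsum 0)
      rw [this]
      exact memLp_finsetSum _ fun i _ => (hW i).const_mul (t i)
    have hYmean : P[Y 0] = inner ℝ c t := by
      simp_rw [hYsum]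
      rw [integral_finsetSum _ fun i _ => ((hW i).integrable (by simp)).const_mul (t i)]
      simp_rw [integral_const_mul, hc]
      simp [PiLp.inner_apply]
    have hYvar : Var[Y 0; P] = t.ofLp ⬝ᵥ S *ᵥ t.ofLp :=
      variance_inner_eq_dotProduct_mulVec hW hS t.ofLp
    have hYindep : iIndepFun Y P := hindep.comp (fun _ x => inner ℝ x t) (fun _ => hinner)
    have hYident (n : ℕ) : IdentDistrib (Y n) (Y 0) P P := (hident n).comp hinner
    have clt := (tendstoInDistribution_inv_sqrt_mul_sum_sub (HasLaw.id) hYL2 hYindep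
      hYident).tendsto
    -- Cramér–Wold: the characteristic function of the vector at `t` is that of its projection on
    -- `t` at 1.
    have h1 := ProbabilityMeasure.tendsto_iff_tendsto_charFun.1 clt 1
    convert! h1 using 2 with n
    · simp only [ProbabilityMeasure.coe_mk]
      rw [charFun_apply, charFun_apply, integral_map (by fun_prop) (by fun_prop),
        integral_map (by fun_prop) (by fun_prop)]
      congr with ω
      congr 3
      rw [hYmean]
      simp [hYdef, inner_smul_left, inner_sub_left, sum_inner]
    · simp only [ProbabilityMeasure.coe_mk, Measure.map_id]
      rw [charFun_multivariateGaussian (posSemidef_of_eq_covariance hW hS), charFun_gaussianReal,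
        Real.coe_toNNReal _ (variance_nonneg _ _), hYvar]
      simp

end CLT

end ProbabilityTheory

namespace ProbabilityTheory

/-! ### Moments of the standard Gaussian law -/

section GaussianMoments

theorem integrable_pow_gaussianReal (n : ℕ) :
    Integrable (fun x : ℝ => x ^ n) (gaussianReal 0 1) := by
  have h := (memLp_id_gaussianReal (μ := 0) (v := 1) n).integrable_norm_pow'
  rw [← integrable_norm_iff (by fun_prop)]
  simpa [norm_pow] using h

theorem integrable_pow_mul_gaussianPDFReal (n : ℕ) :
    Integrable (fun x : ℝ => x ^ n * gaussianPDFReal 0 1 x) := by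
  have h := integrable_pow_gaussianReal n
  rw [gaussianReal, if_neg one_ne_zero, integrable_withDensity_iff_integrable_smul'
    (measurable_gaussianPDF _ _) (ae_of_all _ fun _ => gaussianPDF_lt_top)] at h
  simpa [toReal_gaussianPDF, mul_comm] using h

theorem hasDerivAt_gaussianPDFReal_zero_one (x : ℝ) :
    HasDerivAt (gaussianPDFReal 0 1) (-(x * gaussianPDFReal 0 1 x)) x := by
  have h : HasDerivAt (fun y : ℝ => -(y - 0) ^ 2 / (2 * ((1 : NNReal) : ℝ))) (-x) x := by
    have := ((((hasDerivAt_id x).sub_const 0).pow 2).neg).div_const (2 * ((1 : NNReal) : ℝ))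
    convert! this using 1
    simp
    ring
  rw [gaussianPDFReal_def]
  convert! h.exp.const_mul (√(2 * Real.pi * ((1 : NNReal) : ℝ)))⁻¹ using 1
  ring

/-- Stein's recursion for the moments of the standard Gaussian law. -/
theorem integral_pow_add_two_gaussianReal (n : ℕ) :
    ∫ x, x ^ (n + 2) ∂gaussianReal 0 1 = (n + 1) * ∫ x, x ^ n ∂gaussianReal 0 1 := by
  simp only [integral_gaussianReal_eq_integral_smul one_ne_zero, smul_eq_mul]
  -- Integration by parts with φ' = -xφ; integrability of the product removes the boundary terms.
  have key := integral_mul_deriv_eq_deriv_mul_of_integrable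
    (u := fun x : ℝ => x ^ (n + 1)) (u' := fun x => (n + 1) * x ^ n)
    (v := gaussianPDFReal 0 1) (v' := fun x => -(x * gaussianPDFReal 0 1 x))
    (fun x _ => by simpa using hasDerivAt_pow (n + 1) x)
    (fun x _ => hasDerivAt_gaussianPDFReal_zero_one x)
    (by
      refine (integrable_pow_mul_gaussianPDFReal (n + 2)).neg.congr (ae_of_all _ fun x => ?_)
      simp only [Pi.mul_apply, Pi.neg_apply]
      ring)
    (by
      refine ((integrable_pow_mul_gaussianPDFReal n).const_mul (n + 1)).congr
        (ae_of_all _ fun x => ?_)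
      simp only [Pi.mul_apply]
      ring)
    (integrable_pow_mul_gaussianPDFReal (n + 1))
  rw [← integral_const_mul]
  calc ∫ x, gaussianPDFReal 0 1 x * x ^ (n + 2)
      = - ∫ x, x ^ (n + 1) * -(x * gaussianPDFReal 0 1 x) := by
        rw [← integral_neg]
        congr with x
        ring
    _ = ∫ x, (n + 1) * x ^ n * gaussianPDFReal 0 1 x := by rw [key, neg_neg]
    _ = _ := by
        congr with x
        ring

theorem integral_pow_odd_gaussianReal (k : ℕ) : ∫ x, x ^ (2 * k + 1) ∂gaussianReal 0 1 = 0 := by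
  induction k with
  | zero => simp
  | succ k ih =>
    rw [show 2 * (k + 1) + 1 = 2 * k + 1 + 2 by ring, integral_pow_add_two_gaussianReal, ih,
      mul_zero]

end GaussianMoments

/-! ### Moments of the gamma law -/

section GammaMoments

variable {a : ℝ}

theorem gammaPDFReal_one_mul_pow_ae_eq (a : ℝ) (n : ℕ) :
    (fun x => gammaPDFReal a 1 x * x ^ n) =ᵐ[volume]
      (Set.Ioi 0).indicator
        (fun x => (Real.Gamma a)⁻¹ * (Real.exp (-x) * x ^ (a + n - 1))) := by
  have h0 : ∀ᵐ x : ℝ, x ≠ 0 := by simp [ae_iff]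
  filter_upwards [h0] with x hx
  rcases lt_or_gt_of_ne hx with h | h
  · simp [gammaPDFReal, h.not_ge, h.le]
  · rw [Set.indicator_of_mem (Set.mem_Ioi.2 h), gammaPDFReal, if_pos h.le,
      show a + n - 1 = a - 1 + n by ring, Real.rpow_add h, Real.rpow_natCast]
    simp only [Real.one_rpow, one_mul, one_div]
    ring

theorem integrable_pow_gammaMeasure (ha : 0 < a) (n : ℕ) :
    Integrable (fun x : ℝ => x ^ n) (gammaMeasure a 1) := by
  have hm : Measurable (gammaPDF a 1) := (measurable_gammaPDFReal a 1).ennreal_ofReal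
  rw [gammaMeasure, integrable_withDensity_iff_integrable_smul' hm
    (ae_of_all _ fun _ => ENNReal.ofReal_lt_top)]
  simp only [gammaPDF, ENNReal.toReal_ofReal (gammaPDFReal_nonneg ha one_pos _), smul_eq_mul]
  rw [integrable_congr (gammaPDFReal_one_mul_pow_ae_eq a n),
    integrable_indicator_iff measurableSet_Ioi]
  exact (Real.GammaIntegral_convergent (by positivity)).const_mul _

theorem integral_pow_gammaMeasure (ha : 0 < a) (n : ℕ) :
    ∫ x, x ^ n ∂gammaMeasure a 1 = Real.Gamma (a + n) / Real.Gamma a := by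
  have hm : Measurable (gammaPDF a 1) := (measurable_gammaPDFReal a 1).ennreal_ofReal
  rw [gammaMeasure, integral_withDensity_eq_integral_toReal_smul hm
    (ae_of_all _ fun _ => ENNReal.ofReal_lt_top)]
  simp only [gammaPDF, ENNReal.toReal_ofReal (gammaPDFReal_nonneg ha one_pos _), smul_eq_mul]
  rw [integral_congr_ae (gammaPDFReal_one_mul_pow_ae_eq a n),
    integral_indicator measurableSet_Ioi, integral_const_mul,
    ← Real.Gamma_eq_integral (by positivity)]
  ring

theorem ae_nonneg_gammaMeasure (a : ℝ) : ∀ᵐ x ∂gammaMeasure a 1, 0 ≤ x := by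
  have hm : Measurable (gammaPDF a 1) := (measurable_gammaPDFReal a 1).ennreal_ofReal
  rw [gammaMeasure, ae_withDensity_iff hm]
  refine ae_of_all _ fun x hx => ?_
  by_contra h
  exact hx (gammaPDF_of_neg (not_le.1 h))

/-- The moments of `Γ(a, 1)` satisfy the recursion of the rising factorial. -/
theorem integral_pow_succ_gammaMeasure (ha : 0 < a) (n : ℕ) :
    ∫ x, x ^ (n + 1) ∂gammaMeasure a 1 = (a + n) * ∫ x, x ^ n ∂gammaMeasure a 1 := by
  rw [integral_pow_gammaMeasure ha, integral_pow_gammaMeasure ha, Nat.cast_add, Nat.cast_one,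
    ← add_assoc, Real.Gamma_add_one (by positivity)]
  ring

end GammaMoments

end ProbabilityTheory

/-! ### Central moments of the variance-gamma law -/

namespace SVG

variable {m a b : ℝ}

theorem isProbabilityMeasure_law (ha : 0 < a) : IsProbabilityMeasure (law m a b) := by
  have := isProbabilityMeasure_gammaMeasure ha one_pos
  exact Measure.isProbabilityMeasure_map (by fun_prop)

theorem integrable_sqrt_mul_pow_gammaMeasure (ha : 0 < a) (b : ℝ) (n : ℕ) :
    Integrable (fun g => √(b * g) ^ n) (gammaMeasure a 1) := by
  have := isProbabilityMeasure_gammaMeasure ha one_pos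
  have h := ((integrable_pow_gammaMeasure ha n).const_mul (b ^ n)).norm
  refine ((integrable_const 1).add h).mono' (by fun_prop) (ae_of_all _ fun g => ?_)
  have h1 : √(b * g) ^ 2 ≤ |b * g| := by
    rcases le_total 0 (b * g) with h | h
    · rw [Real.sq_sqrt h]
      exact le_abs_self _
    · rw [Real.sqrt_eq_zero_of_nonpos h, zero_pow two_ne_zero]
      exact abs_nonneg _
  have h2 : (√(b * g) ^ n) ^ 2 ≤ |b * g| ^ n := by
    rw [← pow_mul, mul_comm n 2, pow_mul]
    exact pow_le_pow_left₀ (sq_nonneg _) h1 n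
  rw [Real.norm_of_nonneg (by positivity), Pi.add_apply, ← mul_pow, norm_pow, Real.norm_eq_abs]
  -- With y = `√(b * g) ^ n`, use 2y ≤ 1 + y² to reach integer powers of g.
  nlinarith [sq_nonneg (√(b * g) ^ n - 1)]

theorem integrable_sub_pow_law (ha : 0 < a) (m b : ℝ) (n : ℕ) :
    Integrable (fun x => (x - m) ^ n) (law m a b) := by
  have := isProbabilityMeasure_gammaMeasure ha one_pos
  rw [law, integrable_map_measure (by fun_prop) (by fun_prop)]
  refine ((integrable_sqrt_mul_pow_gammaMeasure ha b n).mul_prod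
    (integrable_pow_gaussianReal n)).congr (ae_of_all _ fun p => ?_)
  simp [mul_pow]

theorem integral_sub_pow_law (ha : 0 < a) (m b : ℝ) (n : ℕ) :
    ∫ x, (x - m) ^ n ∂law m a b =
      (∫ g, √(b * g) ^ n ∂gammaMeasure a 1) * ∫ z, z ^ n ∂gaussianReal 0 1 := by
  have := isProbabilityMeasure_gammaMeasure ha one_pos
  rw [law, integral_map (by fun_prop) (by fun_prop), ← integral_prod_mul]
  simp [mul_pow]

theorem integral_sub_pow_law_odd (ha : 0 < a) (m b : ℝ) (k : ℕ) :
    ∫ x, (x - m) ^ (2 * k + 1) ∂law m a b = 0 := by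
  rw [integral_sub_pow_law ha, integral_pow_odd_gaussianReal, mul_zero]

theorem integral_sub_pow_law_even (ha : 0 < a) (hb : 0 < b) (m : ℝ) (k : ℕ) :
    ∫ x, (x - m) ^ (2 * k) ∂law m a b =
      b ^ k * (∫ g, g ^ k ∂gammaMeasure a 1) * ∫ z, z ^ (2 * k) ∂gaussianReal 0 1 := by
  suffices h : ∫ g, √(b * g) ^ (2 * k) ∂gammaMeasure a 1 =
      ∫ g, b ^ k * g ^ k ∂gammaMeasure a 1 by
    rw [integral_sub_pow_law ha, h, integral_const_mul]
  refine integral_congr_ae ?_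
  filter_upwards [ae_nonneg_gammaMeasure a] with g hg
  rw [pow_mul, Real.sq_sqrt (by positivity), mul_pow]

/-- The recursion for the even central moments of the symmetric variance-gamma law. -/
theorem integral_sub_pow_law_even_succ (ha : 0 < a) (hb : 0 < b) (m : ℝ) (k : ℕ) :
    ∫ x, (x - m) ^ (2 * (k + 1)) ∂law m a b =
      b * (a + k) * (2 * k + 1) * ∫ x, (x - m) ^ (2 * k) ∂law m a b := by
  rw [integral_sub_pow_law_even ha hb, integral_sub_pow_law_even ha hb,
    integral_pow_succ_gammaMeasure ha, mul_add, mul_one, integral_pow_add_two_gaussianReal]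
  push_cast
  ring

/-- The central moment of order `n` of the symmetric variance-gamma law. -/
noncomputable def centralMoment (a b : ℝ) (n : ℕ) : ℝ :=
  if n % 2 = 1 then 0 else
    ∏ k ∈ Finset.range (n / 2), b * (a + k) * (2 * k + 1)

theorem integral_sub_pow_law_eq_centralMoment (ha : 0 < a) (hb : 0 < b) (m : ℝ) (n : ℕ) :
    ∫ x, (x - m) ^ n ∂law m a b = centralMoment a b n := by
  have := isProbabilityMeasure_law (m := m) (b := b) ha
  rcases Nat.even_or_odd' n with ⟨k, rfl | rfl⟩
  · have h (k : ℕ) : centralMoment a b (2 * k) =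
        ∏ k ∈ Finset.range k, b * (a + k) * (2 * k + 1) := by
      simp [centralMoment]
    rw [h]
    induction k with
    | zero => simp
    | succ k ih =>
      rw [integral_sub_pow_law_even_succ ha hb, ih, Finset.prod_range_succ]
      ring
  · rw [integral_sub_pow_law_odd ha, centralMoment, if_pos (by omega)]

end SVG

/-! ### The moment map and its derivative -/

namespace SVG

open scoped Matrix

/-- The vector of the first four powers of `x - m`. -/
noncomputable def powers (m x : ℝ) : EuclideanSpace ℝ (Fin 4) :=
  WithLp.toLp 2 fun i => (x - m) ^ ((i : ℕ) + 1)

/-- The centered second moment in terms of the raw moments. -/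
noncomputable def momentV (x : EuclideanSpace ℝ (Fin 4)) : ℝ := x 1 - x 0 ^ 2

/-- The centered fourth moment in terms of the raw moments. -/
noncomputable def momentK (x : EuclideanSpace ℝ (Fin 4)) : ℝ :=
  x 3 - 4 * x 0 * x 2 + 6 * x 0 ^ 2 * x 1 - 3 * x 0 ^ 4

/-- The parameters `(m, a, b)` as a function of the first four moments about the point `m`. -/
noncomputable def momentMap (m : ℝ) (x : EuclideanSpace ℝ (Fin 4)) : EuclideanSpace ℝ (Fin 3) :=
  !₂[m + x 0, 3 * momentV x ^ 2 / (momentK x - 3 * momentV x ^ 2),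
    momentK x / (3 * momentV x) - momentV x]

/-- The derivative of `momentMap` at the moments of the symmetric variance-gamma law. -/
noncomputable def jacobian (a b : ℝ) : Matrix (Fin 3) (Fin 4) ℝ :=
  !![1, 0, 0, 0;
     0, 2 * (1 + a) / b, 0, -1 / (3 * b ^ 2);
     0, -(2 * a + 1) / a, 0, 1 / (3 * a * b)]

/-- The moments of orders one to four. -/
noncomputable def momentVector (a b : ℝ) : EuclideanSpace ℝ (Fin 4) :=
  WithLp.toLp 2 fun i => centralMoment a b ((i : ℕ) + 1)

/-- The covariance matrix of the first four powers. -/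
noncomputable def momentCov (a b : ℝ) : Matrix (Fin 4) (Fin 4) ℝ :=
  Matrix.of fun i j => centralMoment a b ((i : ℕ) + 1 + ((j : ℕ) + 1)) -
    centralMoment a b ((i : ℕ) + 1) * centralMoment a b ((j : ℕ) + 1)

theorem momentCov_apply (a b : ℝ) (i j : Fin 4) :
    momentCov a b i j = centralMoment a b ((i : ℕ) + 1 + ((j : ℕ) + 1)) -
      centralMoment a b ((i : ℕ) + 1) * centralMoment a b ((j : ℕ) + 1) := rfl

variable {m a b : ℝ}

theorem jacobian_mul_momentCov_mul_transpose (ha : 0 < a) (hb : 0 < b) :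
    jacobian a b * momentCov a b * (jacobian a b)ᵀ = limitCov a b := by
  ext i j
  simp only [Matrix.mul_apply, Fin.sum_univ_four, Matrix.transpose_apply, momentCov_apply]
  fin_cases i <;> fin_cases j <;>
    simp [jacobian, centralMoment, limitCov, sigma, Finset.prod_range_succ]
  all_goals
    try field_simp
    try ring

section Empirical

variable (m) (x : ℕ → ℝ) {N : ℕ}

theorem mean_powers_apply (N : ℕ) (i : Fin 4) :
    ((N : ℝ)⁻¹ • ∑ k ∈ Finset.range N, powers m (x k)) i =
      (∑ k ∈ Finset.range N, (x k - m) ^ ((i : ℕ) + 1)) / N := by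
  simp [powers, div_eq_inv_mul]

theorem mean_eq_add (hN : N ≠ 0) :
    mean x N = m + (∑ k ∈ Finset.range N, (x k - m)) / N := by
  rw [Finset.sum_sub_distrib, mean]
  simp
  field_simp
  ring

/-- Central moments are translation invariant, so the powers may be centered at the unknown `m`. -/
theorem vHat_eq_momentV (hN : N ≠ 0) :
    vHat x N = momentV ((N : ℝ)⁻¹ • ∑ k ∈ Finset.range N, powers m (x k)) := by
  have h (k : ℕ) (c : ℝ) : (x k - (m + c)) ^ 2 =
      (x k - m) ^ 2 + (-2 * c) * (x k - m) + c ^ 2 := by ring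
  simp only [vHat, momentV, mean_powers_apply, mean_eq_add m x hN, h, Finset.sum_add_distrib,
    ← Finset.mul_sum, Finset.sum_const, Finset.card_range, nsmul_eq_mul]
  simp only [Fin.val_zero, Fin.val_one, zero_add, pow_one, Nat.reduceAdd]
  field_simp
  ring

theorem kHat_eq_momentK (hN : N ≠ 0) :
    kHat x N = momentK ((N : ℝ)⁻¹ • ∑ k ∈ Finset.range N, powers m (x k)) := by
  have h (k : ℕ) (c : ℝ) : (x k - (m + c)) ^ 4 = (x k - m) ^ 4 + (-4 * c) * (x k - m) ^ 3
      + 6 * c ^ 2 * (x k - m) ^ 2 + (-4 * c ^ 3) * (x k - m) + c ^ 4 := by ring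
  simp only [kHat, momentK, mean_powers_apply, mean_eq_add m x hN, h, Finset.sum_add_distrib,
    ← Finset.mul_sum, Finset.sum_const, Finset.card_range, nsmul_eq_mul]
  simp only [Fin.val_zero, Fin.val_one, Fin.val_two, show ((3 : Fin 4) : ℕ) = 3 from rfl,
    zero_add, pow_one, Nat.reduceAdd]
  field_simp
  ring

theorem momentMap_mean_powers (hN : N ≠ 0) :
    momentMap m ((N : ℝ)⁻¹ • ∑ k ∈ Finset.range N, powers m (x k)) =
      !₂[mean x N, aHat x N, bHat x N] := by
  rw [momentMap, ← vHat_eq_momentV m x hN, ← kHat_eq_momentK m x hN, mean_powers_apply,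
    mean_eq_add m x hN, aHat, bHat]
  simp

end Empirical

theorem momentV_momentVector (a b : ℝ) : momentV (momentVector a b) = a * b := by
  simp [momentV, momentVector, centralMoment]
  ring

theorem momentK_momentVector (a b : ℝ) :
    momentK (momentVector a b) = 3 * a * (a + 1) * b ^ 2 := by
  simp [momentK, momentVector, centralMoment, Finset.prod_range_succ]
  ring

theorem momentMap_momentVector (m : ℝ) (ha : 0 < a) (hb : 0 < b) :
    momentMap m (momentVector a b) = !₂[m, a, b] := by
  have h : 3 * a * (a + 1) * b ^ 2 - 3 * (a * b) ^ 2 = 3 * a * b ^ 2 := by ring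
  rw [momentMap, momentV_momentVector, momentK_momentVector, h]
  have h1 : 3 * (a * b) ^ 2 / (3 * a * b ^ 2) = a := by field_simp
  have h2 : 3 * a * (a + 1) * b ^ 2 / (3 * (a * b)) - a * b = b := by field_simp; ring
  rw [h1, h2]
  simp [momentVector, centralMoment]

theorem hasFDerivAt_momentV (a b : ℝ) :
    HasFDerivAt momentV (PiLp.proj 2 (fun _ : Fin 4 => ℝ) 1 : _ →L[ℝ] ℝ) (momentVector a b) := by
  have h (i : Fin 4) := PiLp.hasFDerivAt_apply (𝕜 := ℝ) 2 (momentVector a b) i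
  convert! (h 1).sub ((h 0).pow 2) using 1
  ext v
  simp [momentVector, centralMoment]

/-- The first and third moments vanish at the base point, so every correction term has zero
differential there. -/
theorem hasFDerivAt_momentK (a b : ℝ) :
    HasFDerivAt momentK (PiLp.proj 2 (fun _ : Fin 4 => ℝ) 3 : _ →L[ℝ] ℝ) (momentVector a b) := by
  have h (i : Fin 4) := PiLp.hasFDerivAt_apply (𝕜 := ℝ) 2 (momentVector a b) i
  convert! (((h 3).sub (((h 0).const_mul 4).mul (h 2))).add
    ((((h 0).pow 2).const_mul 6).mul (h 1))).sub (((h 0).pow 4).const_mul 3) using 1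
  ext v
  simp [momentVector, centralMoment]

theorem hasFDerivAt_div {E : Type*} [NormedAddCommGroup E] [NormedSpace ℝ E] {f g : E → ℝ}
    {f' g' : E →L[ℝ] ℝ} {x : E} (hf : HasFDerivAt f f' x) (hg : HasFDerivAt g g' x)
    (hx : g x ≠ 0) :
    HasFDerivAt (fun y => f y / g y) ((g x)⁻¹ • f' - (f x / g x ^ 2) • g') x := by
  have h : HasFDerivAt (fun y => (g y)⁻¹) (-(g x ^ 2)⁻¹ • g') x :=
    (hasDerivAt_inv hx).comp_hasFDerivAt x hg
  simp only [div_eq_mul_inv]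
  convert! hf.mul h using 1
  ext v
  simp
  ring

theorem hasFDerivAt_momentMap (m : ℝ) (ha : 0 < a) (hb : 0 < b)
    {L : EuclideanSpace ℝ (Fin 4) →L[ℝ] EuclideanSpace ℝ (Fin 3)}
    (hL : ∀ x : EuclideanSpace ℝ (Fin 4), (L x).ofLp = jacobian a b *ᵥ x.ofLp) :
    HasFDerivAt (momentMap m) L (momentVector a b) := by
  have hV := hasFDerivAt_momentV a b
  have hK := hasFDerivAt_momentK a b
  -- The excess fourth moment is positive, so the quotient is differentiable.
  have hD : momentK (momentVector a b) - 3 * momentV (momentVector a b) ^ 2 = 3 * a * b ^ 2 := by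
    rw [momentV_momentVector, momentK_momentVector]
    ring
  have hD0 : 3 * a * b ^ 2 ≠ 0 := by positivity
  have hE0 : 3 * momentV (momentVector a b) ≠ 0 := by
    rw [momentV_momentVector]
    positivity
  rw [← hasFDerivWithinAt_univ, hasFDerivWithinAt_euclidean]
  intro i
  rw [hasFDerivWithinAt_univ]
  fin_cases i
  · convert! (PiLp.hasFDerivAt_apply (𝕜 := ℝ) 2 (momentVector a b) 0).const_add m using 1
    ext v
    simp [hL, jacobian, Matrix.mulVec, dotProduct, Fin.sum_univ_four]
  · convert! hasFDerivAt_div ((hV.pow 2).const_mul 3) (hK.sub ((hV.pow 2).const_mul 3))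
      (by rwa [Pi.sub_apply, hD]) using 1
    ext v
    simp [hL, jacobian, Matrix.mulVec, dotProduct, Fin.sum_univ_four, momentV_momentVector,
      momentK_momentVector]
    field_simp
    ring
  · convert! (hasFDerivAt_div hK (hV.const_mul 3) hE0).sub hV using 1
    ext v
    simp [hL, jacobian, Matrix.mulVec, dotProduct, Fin.sum_univ_four, momentV_momentVector,
      momentK_momentVector]
    field_simp
    ring

theorem measurable_momentMap (m : ℝ) : Measurable (momentMap m) := by
  have hV : Measurable momentV := by unfold momentV; fun_prop
  have hK : Measurable momentK := by unfold momentK; fun_prop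
  refine (WithLp.measurable_toLp 2 _).comp (measurable_pi_lambda _ fun i => ?_)
  fin_cases i
  · exact (show Measurable fun x : EuclideanSpace ℝ (Fin 4) => m + x 0 by fun_prop)
  · exact ((hV.pow_const 2).const_mul 3).div (hK.sub ((hV.pow_const 2).const_mul 3))
  · exact (hK.div (hV.const_mul 3)).sub hV

theorem measurable_powers (m : ℝ) : Measurable (powers m) := by
  unfold powers
  fun_prop

theorem memLp_powers_law (ha : 0 < a) (m b : ℝ) (i : Fin 4) :
    MemLp (fun x => powers m x i) 2 (law m a b) := by
  rw [memLp_two_iff_integrable_sq (by unfold powers; fun_prop)]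
  simpa [powers, ← pow_mul] using integrable_sub_pow_law ha m b (((i : ℕ) + 1) * 2)

theorem integral_powers_law (ha : 0 < a) (hb : 0 < b) (m : ℝ) (i : Fin 4) :
    ∫ x, powers m x i ∂law m a b = momentVector a b i :=
  integral_sub_pow_law_eq_centralMoment ha hb m _

theorem covariance_powers_law (ha : 0 < a) (hb : 0 < b) (m : ℝ) (i j : Fin 4) :
    cov[fun x => powers m x i, fun x => powers m x j; law m a b] = momentCov a b i j := by
  have := isProbabilityMeasure_law (m := m) (b := b) ha
  rw [covariance_eq_sub (memLp_powers_law ha m b i) (memLp_powers_law ha m b j),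
    integral_powers_law ha hb, integral_powers_law ha hb]
  have h : ((fun x => powers m x i) * fun x => powers m x j) =
      fun x => (x - m) ^ ((i : ℕ) + 1 + ((j : ℕ) + 1)) := by
    ext x
    simp [powers, pow_add]
  rw [h, integral_sub_pow_law_eq_centralMoment ha hb]
  rfl

end SVG

/-! ### Asymptotic normality of the estimators -/

theorem theorem4 {Ω : Type*} [MeasurableSpace Ω] (P : Measure Ω) [IsProbabilityMeasure P]
    (m a b : ℝ) (ha : 0 < a) (hb : 0 < b)
    (X : ℕ → Ω → ℝ) (hlaw : ∀ i, HasLaw (X i) (SVG.law m a b) P) (hindep : iIndepFun X P) :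
    (SVG.limitCov a b).PosSemidef ∧
      TendstoInDistribution
        (fun (N : ℕ) (ω : Ω) => √(N : ℝ) •
          (!₂[SVG.mean (fun i => X i ω) N, SVG.aHat (fun i => X i ω) N,
              SVG.bHat (fun i => X i ω) N] - !₂[m, a, b] : EuclideanSpace ℝ (Fin 3)))
        atTop (id : EuclideanSpace ℝ (Fin 3) → EuclideanSpace ℝ (Fin 3)) (fun _ => P)
        (multivariateGaussian 0 (SVG.limitCov a b)) := by
  have := SVG.isProbabilityMeasure_law (m := m) (b := b) ha
  set W : ℕ → Ω → EuclideanSpace ℝ (Fin 4) := fun k ω => SVG.powers m (X k ω) with hW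
  have hpm := SVG.measurable_powers m
  have hcoord (i : Fin 4) : Measurable fun x => SVG.powers m x i := by fun_prop
  have hWm (k : ℕ) : AEMeasurable (W k) P := hpm.comp_aemeasurable (hlaw k).aemeasurable
  have hident (k : ℕ) : IdentDistrib (W k) (W 0) P P :=
    have h : IdentDistrib (X k) (X 0) P P := ⟨(hlaw k).aemeasurable, (hlaw 0).aemeasurable,
      (hlaw k).map_eq.trans (hlaw 0).map_eq.symm⟩
    h.comp hpm
  have hWindep : iIndepFun W P := hindep.comp (fun _ => SVG.powers m) (fun _ => hpm)
  have hL2 (i : Fin 4) : MemLp (fun ω => W 0 ω i) 2 P := by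
    have h := SVG.memLp_powers_law ha m b i
    rw [← (hlaw 0).map_eq] at h
    exact h.comp_of_map (hlaw 0).aemeasurable
  have hmean (i : Fin 4) : ∫ ω, W 0 ω i ∂P = SVG.momentVector a b i :=
    ((hlaw 0).integral_comp (hcoord i).aestronglyMeasurable).trans
      (SVG.integral_powers_law ha hb m i)
  have hcov (i j : Fin 4) : SVG.momentCov a b i j =
      cov[fun ω => W 0 ω i, fun ω => W 0 ω j; P] :=
    (SVG.covariance_powers_law ha hb m i j).symm.trans
      ((hlaw 0).covariance_fun_comp (hcoord i).aemeasurable (hcoord j).aemeasurable).symm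
  have hS : (SVG.momentCov a b).PosSemidef := posSemidef_of_eq_covariance hL2 hcov
  have hprod := SVG.jacobian_mul_momentCov_mul_transpose ha hb
  refine ⟨by simpa [hprod] using hS.mul_mul_conjTranspose_same (SVG.jacobian a b), ?_⟩
  set T : ℕ → Ω → EuclideanSpace ℝ (Fin 4) :=
    fun N ω => (N : ℝ)⁻¹ • ∑ k ∈ Finset.range N, W k ω with hT
  have hlln : ∀ᵐ ω ∂P, Tendsto (fun N => T N ω) atTop (𝓝 (SVG.momentVector a b)) := by
    have hint : Integrable (W 0) P := by
      refine MemLp.integrable (q := 2) (by simp) ?_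
      exact memLp_piLp_iff.2 hL2
    have hmean' : P[W 0] = SVG.momentVector a b := by
      ext i
      rw [eval_integral_piLp, hmean]
      exact fun i => (hL2 i).integrable (by simp)
    rw [← hmean']
    exact strong_law_ae W hint (fun i j hij => hWindep.indepFun hij) hident
  have hclt : TendstoInDistribution (fun (N : ℕ) ω => √(N : ℝ) • (T N ω - SVG.momentVector a b))
      atTop id (fun _ => P) (multivariateGaussian 0 (SVG.momentCov a b)) := by
    convert! tendstoInDistribution_inv_sqrt_smul_sum_sub hWindep hident hL2 hmean hcov
      using 3 with N ω
    rcases eq_or_ne N 0 with rfl | hN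
    · simp
    · rw [hT]
      have h1 : (√(N : ℝ))⁻¹ = √(N : ℝ) * (N : ℝ)⁻¹ := by
        rw [← div_eq_mul_inv, Real.sqrt_div_self]
      have h2 : (N : ℝ) ≠ 0 := by exact_mod_cast hN
      rw [h1, mul_smul, smul_sub (N : ℝ)⁻¹, smul_smul (N : ℝ)⁻¹, inv_mul_cancel₀ h2, one_smul]
  set L : EuclideanSpace ℝ (Fin 4) →L[ℝ] EuclideanSpace ℝ (Fin 3) :=
    (Matrix.toLpLin 2 2 (SVG.jacobian a b)).toContinuousLinearMap
  have hL (x : EuclideanSpace ℝ (Fin 4)) : (L x).ofLp = (SVG.jacobian a b).mulVec x.ofLp := rfl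
  have hdelta := tendstoInDistribution_smul_comp_sub (fun N => Real.sqrt_nonneg (N : ℝ))
    (SVG.hasFDerivAt_momentMap m ha hb hL) (SVG.measurable_momentMap m)
    (fun N => by fun_prop) hlln hclt
  have hlim := tendstoInDistribution_of_map_eq
    (P'' := multivariateGaussian 0 (SVG.limitCov a b)) hdelta aemeasurable_id (by
      rw [Measure.map_id, ← hprod]
      exact map_multivariateGaussian_zero hS _ L hL)
  refine hlim.congr (fun N => ae_of_all _ fun ω => ?_) (ae_of_all _ fun _ => rfl)
  -- The algebraic identity needs `N ≠ 0`; at `N = 0` the factor `√0` kills both sides.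
  rcases eq_or_ne N 0 with rfl | hN
  · simp
  · simp only [SVG.momentMap_momentVector m ha hb, hT, hW]
    rw [SVG.momentMap_mean_powers m (fun k => X k ω) hN]
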